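/- Let $D$ be a set with a partial order $<$ and let $\rho:\mathbb{N}\to D$ be a bijection such that $\{(m,n):\rho(m)<\rho(n)\}$ is computable; write $\mathcal{D}=(D,<,\rho)$. A partial function $F:X\to D$, where $X$ is $\{0,1\}^*$ or $\{0,1\}^*\times\mathbb{N}$, is called partial computable if $\rho^{-1}\circ F$ is. Let $\mathrm{Max}(\mathcal{D})$ be the class of partial functions $\max f:\{0,1\}^*\to D$, where $f:\{0,1\}^*\times\mathbb{N}\to D$ is partial computable and monotone increasing in its second argument on its domain; here $(\max f)(p)$ is defined iff the set $\{f(p,t): t\in\mathbb{N},\ f(p,t)\text{ defined}\}$ is finite and non-empty, and it is then the greatest element of this set. Let $\mathrm{Min}(\mathcal{D})$ be the analogous class for the reverse order: $f$ is monotone decreasing in its second argument and greatest elements are replaced by least elements. For a partial function $\varphi:\{0,1\}^*\to D$ and $d$ in the range of $\varphi$ put $K_\varphi(d)=\min\{|p|:\varphi(p)=d\}$. A function $\varphi$ in a class $C$ of partial functions $\{0,1\}^*\to D$ is optimal in $C$ if for every $\psi\in C$ there is a constant $c$ such that every $d$ in the range of $\psi$ is in the range of $\varphi$ and satisfies $K_\varphi(d)\le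 K_\psi(d)+c$. Let $K^D$, $K^{\mathcal D}_{\max}$, $K^{\mathcal D}_{\min}$ be $K_\varphi$, $K_U$, $K_V$, where $\varphi$, $U$, $V$ are any functions that are optimal in the class of partial computable functions $\{0,1\}^*\to D$, in $\mathrm{Max}(\mathcal{D})$ and in $\mathrm{Min}(\mathcal{D})$, respectively (these are total functions $D\to\mathbb{N}$). For $f,g:D\to\mathbb{N}$ write $f\le_{\rm ct}g$ if $\exists c\,\forall d\ f(d)\le g(d)+c$, write $f=_{\rm ct}g$ if $f\le_{\rm ct}g$ and $g\le_{\rm ct}f$, and write $f<_{\rm ct}g$ if $f\le_{\rm ct}g$ but not $g\le_{\rm ct}f$. 1. If $(D,<)$ contains arbitrarily large finite chains, then $K^{\mathcal D}_{\max}$ and $K^{\mathcal D}_{\min}$ are $\le_{\rm ct}$-incomparable, and $K^{\mathcal D}_{\max}<_{\rm ct}K^D$ and $K^{\mathcal D}_{\min}<_{\rm ct}K^D$. Moreover, for every total computable function $\alpha:\mathbb{N}\to\mathbb{N}$ the following four sets are infinite: $$\{d\in D: K^D(d)\ge\alpha(K^{\mathcal D}_{\min}(d))\},\qquad \{d\in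 D: K^D(d)\ge\alpha(K^{\mathcal D}_{\max}(d))\},$$ $$\{d\in D: K^{\mathcal D}_{\max}(d)\ge\alpha(K^{\mathcal D}_{\min}(d))\},\qquad \{d\in D: K^{\mathcal D}_{\min}(d)\ge\alpha(K^{\mathcal D}_{\max}(d))\}.$$ 2. If $(D,<)$ does not contain arbitrarily large finite chains, then $K^{\mathcal D}_{\min}=_{\rm ct}K^{\mathcal D}_{\max}=_{\rm ct}K^D$. -/

import Mathlib

namespace MaxMinComplexity

/-- A computable structure on a partially ordered set `D`: a bijection `ρ : ℕ → D` for which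
`{(m, n) : ρ m < ρ n}` is a computable set. -/
structure ComputablePoset (D : Type*) [PartialOrder D] where
  ρ : ℕ ≃ D
  computable_lt : ComputablePred (fun p : ℕ × ℕ => ρ p.1 < ρ p.2)

section Classes

variable {D : Type*} [PartialOrder D] {X : Type*} [Primcodable X]

/-- `F : X → D` is partial computable when `ρ⁻¹ ∘ F : X → ℕ` is. -/
def PartialComputable (𝒟 : ComputablePoset D) (F : X →. D) : Prop :=
  Partrec (fun x => (F x).map 𝒟.ρ.symm)

/-- The set `{f(x,t) : t ∈ ℕ}` of the values that are defined. -/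
def values (f : X × ℕ →. D) (x : X) : Set D :=
  {d | ∃ t : ℕ, d ∈ f (x, t)}

/-- `f` is monotone increasing in its second argument, on its domain. -/
def IncreasingInTime (f : X × ℕ →. D) : Prop :=
  ∀ (x : X) (s t : ℕ) (a b : D), s ≤ t → a ∈ f (x, s) → b ∈ f (x, t) → a ≤ b

/-- `f` is monotone decreasing in its second argument, on its domain. -/
def DecreasingInTime (f : X × ℕ →. D) : Prop :=
  ∀ (x : X) (s t : ℕ) (a b : D), s ≤ t → a ∈ f (x, s) → b ∈ f (x, t) → b ≤ a

/-- `F = max f`: `F(x)` is defined iff `{f(x,t) : t ∈ ℕ}` is finite and non-empty (a finite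
non-empty chain has a greatest element), and it is then the greatest element of that set. -/
def IsMaxOf (f : X × ℕ →. D) (F : X →. D) : Prop :=
  ∀ (x : X) (d : D), d ∈ F x ↔ (values f x).Finite ∧ IsGreatest (values f x) d

/-- `F = min f`: `F(x)` is defined iff `{f(x,t) : t ∈ ℕ}` is finite and non-empty,
and it is then the least element of that set. -/
def IsMinOf (f : X × ℕ →. D) (F : X →. D) : Prop :=
  ∀ (x : X) (d : D), d ∈ F x ↔ (values f x).Finite ∧ IsLeast (values f x) d

/-- The class of the functions `max f`, for `f : X × ℕ → D` partial computable and
monotone increasing in its second argument. -/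
def MaxPR (𝒟 : ComputablePoset D) (F : X →. D) : Prop :=
  ∃ f : X × ℕ →. D, PartialComputable 𝒟 f ∧ IncreasingInTime f ∧ IsMaxOf f F

/-- The class of the functions `min f`, for `f : X × ℕ → D` partial computable and
monotone decreasing in its second argument. -/
def MinPR (𝒟 : ComputablePoset D) (F : X →. D) : Prop :=
  ∃ f : X × ℕ →. D, PartialComputable 𝒟 f ∧ DecreasingInTime f ∧ IsMinOf f F

end Classes

section Complexity

variable {D : Type*}

/-- `K_φ(d) = min {|p| : φ(p) = d}`. It is meaningful for `d` in the range of `φ` (elsewhere the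
infimum takes the value `0`); optimal functions are onto, see `IsOptimal.surjective_plain`,
`IsOptimal.surjective_max` and `IsOptimal.surjective_min`. -/
noncomputable def K (φ : List Bool →. D) (d : D) : ℕ :=
  sInf {n : ℕ | ∃ p : List Bool, d ∈ φ p ∧ p.length = n}

/-- `φ` is optimal in the class `C` of partial functions from binary words to `D`: it lies in `C`
and `K_φ ≤ K_ψ + c` for every `ψ ∈ C`, with `c` depending on `ψ`. As the domain of `K_ψ` is the
range of `ψ`, this includes that the range of `ψ` is contained in that of `φ`. -/
def IsOptimal (C : (List Bool →. D) → Prop) (φ : List Bool →. D) : Prop :=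
  C φ ∧ ∀ ψ : List Bool →. D, C ψ →
    ∃ c : ℕ, ∀ d : D, (∃ p, d ∈ ψ p) → (∃ p, d ∈ φ p) ∧ K φ d ≤ K ψ d + c

/-- `f ≤_ct g`: inequality up to an additive constant. -/
def LeCt (f g : D → ℕ) : Prop := ∃ c : ℕ, ∀ d, f d ≤ g d + c

/-- `f =_ct g`. -/
def EqCt (f g : D → ℕ) : Prop := LeCt f g ∧ LeCt g f

/-- `f <_ct g`. -/
def LtCt (f g : D → ℕ) : Prop := LeCt f g ∧ ¬ LeCt g f

end Complexity

section Chains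

variable (D : Type*) [PartialOrder D]

/-- `D` contains arbitrarily large finite chains. -/
def HasArbitrarilyLargeFiniteChains : Prop :=
  ∀ n : ℕ, ∃ s : Finset D, IsChain (· < ·) (s : Set D) ∧ n ≤ s.card

end Chains

section Totality

variable {D : Type*} [PartialOrder D]

theorem partialComputable_length (𝒟 : ComputablePoset D) :
    PartialComputable 𝒟 (fun p : List Bool => Part.some (𝒟.ρ p.length)) := by
  have h : Computable (fun p : List Bool => p.length) := Primrec.list_length.to_comp
  have h' : Partrec (fun p : List Bool => Part.some p.length) := h.partrec
  refine h'.of_eq fun p => ?_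
  simp

theorem partialComputable_length_fst (𝒟 : ComputablePoset D) :
    PartialComputable 𝒟 (fun q : List Bool × ℕ => Part.some (𝒟.ρ q.1.length)) := by
  have h : Computable (fun q : List Bool × ℕ => q.1.length) :=
    (Primrec.list_length.comp Primrec.fst).to_comp
  have h' : Partrec (fun q : List Bool × ℕ => Part.some q.1.length) := h.partrec
  refine h'.of_eq fun p => ?_
  simp

theorem exists_mem_length (𝒟 : ComputablePoset D) (d : D) :
    ∃ p : List Bool, d ∈ (Part.some (𝒟.ρ p.length) : Part D) :=
  ⟨List.replicate (𝒟.ρ.symm d) true, by simp⟩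

theorem IsOptimal.surjective_plain {𝒟 : ComputablePoset D} {φ : List Bool →. D}
    (h : IsOptimal (PartialComputable 𝒟) φ) (d : D) : ∃ p, d ∈ φ p := by
  obtain ⟨c, hc⟩ := h.2 _ (partialComputable_length 𝒟)
  exact (hc d (exists_mem_length 𝒟 d)).1

theorem IsOptimal.surjective_max {𝒟 : ComputablePoset D} {φ : List Bool →. D}
    (h : IsOptimal (MaxPR 𝒟) φ) (d : D) : ∃ p, d ∈ φ p := by
  have hC : MaxPR 𝒟 (fun p : List Bool => Part.some (𝒟.ρ p.length)) := by
    refine ⟨_, partialComputable_length_fst 𝒟, ?_, ?_⟩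
    · intro x s t a b _ ha hb
      simp_all
    · intro x d
      have hv : values (fun q : List Bool × ℕ => Part.some (𝒟.ρ q.1.length)) x
          = {𝒟.ρ x.length} := by
        ext e; simp [values]
      simp [hv, IsGreatest, upperBounds]
      intro h; exact h.ge
  obtain ⟨c, hc⟩ := h.2 _ hC
  exact (hc d (exists_mem_length 𝒟 d)).1

theorem IsOptimal.surjective_min {𝒟 : ComputablePoset D} {φ : List Bool →. D}
    (h : IsOptimal (MinPR 𝒟) φ) (d : D) : ∃ p, d ∈ φ p := by
  have hC : MinPR 𝒟 (fun p : List Bool => Part.some (𝒟.ρ p.length)) := by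
    refine ⟨_, partialComputable_length_fst 𝒟, ?_, ?_⟩
    · intro x s t a b _ ha hb
      simp_all
    · intro x d
      have hv : values (fun q : List Bool × ℕ => Part.some (𝒟.ρ q.1.length)) x
          = {𝒟.ρ x.length} := by
        ext e; simp [values]
      simp [hv, IsLeast, lowerBounds]
      intro h; exact h.le
  obtain ⟨c, hc⟩ := h.2 _ hC
  exact (hc d (exists_mem_length 𝒟 d)).1

end Totality

end MaxMinComplexity

open MaxMinComplexity

/-! Suppose chains are unbounded and let `β ≥ α` be computable and monotone. For each `n`, a
decreasing approximation that uses `n` alone leads to an element `d n` which is not `U p` for any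
word `p` of length at most `β (2 * n)`. Let `M` exceed the codes of all these words, find a chain of
`M + 1` elements, and walk down it from the top, leaving the current element whenever the increasing
approximation to some `U p` is seen to equal it. An increasing sequence that has shown one element
of the chain never shows a lower one, so each word causes at most one step. The walk therefore stops
inside the chain, on an element that is no limit (`avoidIndex_le`, `exists_avoidIndex_limit`). Thus
`K V (d n) ≤ n + b`, while `K U (d n) ≥ β (2 * n)`. Reversing the order swaps `U` and `V`, and the
sets involving `K φ` follow from `K U, K V ≤ K φ + c`.

If chains have bounded size, an increasing approximation changes a bounded number of times. The word
`p` and the final number of changes determine `U p` computably, and finitely many such numbers cost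
only a constant (`leCt_plain_max`). -/

namespace MaxMinComplexity

/-! ### Enumeration, search, computable bounds -/

section Computability

variable {X : Type*} [Primcodable X]

/-- The range of a partial computable function of a parameter and a number is computably
enumerated, uniformly in the parameter. -/
theorem exists_enumeration {f : X × ℕ →. ℕ} (hf : Partrec f) :
    ∃ r : X → ℕ → Option ℕ, Computable₂ r ∧
      ∀ x v, (∃ s, r x s = some v) ↔ ∃ t, v ∈ f (x, t) := by
  obtain ⟨c, hc⟩ := Nat.Partrec.Code.exists_code.1 hf
  have hmem : ∀ x t v, v ∈ f (x, t) ↔ v ∈ Nat.Partrec.Code.eval c (Encodable.encode (x, t)) := by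
    intro x t v
    rw [hc]
    simp
  refine ⟨fun x s => Nat.Partrec.Code.evaln s.unpair.1 c (Encodable.encode (x, s.unpair.2)),
    ?_, ?_⟩
  · have h1 : Computable fun q : X × ℕ => q.2.unpair.1 :=
      Computable.fst.comp (Computable.unpair.comp Computable.snd)
    have h2 : Computable fun q : X × ℕ => q.2.unpair.2 :=
      Computable.snd.comp (Computable.unpair.comp Computable.snd)
    exact Nat.Partrec.Code.primrec_evaln.to_comp.comp
      ((h1.pair (Computable.const c)).pair
        (Computable.encode.comp (Computable.fst.pair h2)))
  · intro x v
    simp only [hmem, Nat.Partrec.Code.evaln_complete]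
    constructor
    · rintro ⟨s, hs⟩
      exact ⟨_, _, hs⟩
    · rintro ⟨t, k, hk⟩
      exact ⟨Nat.pair k t, by simpa using hk⟩

/-- Minimization of a decidable relation with total choice of witnesses. -/
theorem exists_computable_choice {p : X → ℕ → Bool} (hp : Computable₂ p)
    (h : ∀ x, ∃ n, p x n = true) : ∃ F : X → ℕ, Computable F ∧ ∀ x, p x (F x) = true := by
  have hw : ∀ x, ∃ n, n ∈ Nat.rfind (p x : ℕ →. Bool) := fun x => by
    obtain ⟨m, hm⟩ := h x
    obtain ⟨n, hn, -⟩ := Nat.rfind_min' hm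
    exact ⟨n, hn⟩
  choose F hF using hw
  refine ⟨F, (Partrec.rfind hp.partrec₂).of_eq_tot hF, fun x => ?_⟩
  simpa using Nat.rfind_spec (hF x)

/-- Every computable function is dominated by a monotone computable one, which may be taken
above the identity. -/
theorem exists_monotone_computable_ge {α : ℕ → ℕ} (hα : Computable α) :
    ∃ β : ℕ → ℕ, Computable β ∧ Monotone β ∧ (∀ n, α n ≤ β n) ∧ ∀ n, n ≤ β n := by
  let β : ℕ → ℕ := fun n => Nat.rec (α 0) (fun y ih => ih + α (y + 1) + 1) n
  have hs : ∀ n, β (n + 1) = β n + α (n + 1) + 1 := fun n => rfl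
  refine ⟨β, ?_, monotone_nat_of_le_succ fun n => by rw [hs]; omega, ?_, ?_⟩
  · refine Computable.nat_rec (h := fun _ q => q.2 + α (q.1 + 1) + 1) Computable.id
      (Computable.const _) ?_
    have hy : Computable fun q : ℕ × ℕ × ℕ => q.2.1 := Computable.fst.comp Computable.snd
    have hi : Computable fun q : ℕ × ℕ × ℕ => q.2.2 := Computable.snd.comp Computable.snd
    exact Computable.succ.comp
      (Primrec.nat_add.to_comp.comp hi (hα.comp (Computable.succ.comp hy)))
  · rintro (_ | n)
    · exact le_rfl
    · rw [hs]; omega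
  · intro n
    induction n with
    | zero => exact Nat.zero_le _
    | succ n ih => rw [hs]; omega

/-- A bound for the codes of the binary words of length at most `n`. -/
def wordBound (n : ℕ) : ℕ :=
  Nat.rec 0 (fun _ ih => Nat.pair 1 ih + 1) n

theorem computable_wordBound : Computable wordBound := by
  refine Computable.nat_rec (h := fun _ q => Nat.pair 1 q.2 + 1) Computable.id
    (Computable.const _) ?_
  have hi : Computable fun q : ℕ × ℕ × ℕ => q.2.2 := Computable.snd.comp Computable.snd
  exact Computable.succ.comp (Primrec₂.natPair.to_comp.comp (Computable.const 1) hi)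

theorem monotone_wordBound : Monotone wordBound :=
  monotone_nat_of_le_succ fun n =>
    (Nat.right_le_pair 1 (wordBound n)).trans (Nat.le_succ _)

/-- The code of `b :: l` is `Nat.pair` of the two codes plus one, a bit has code at most `1`, and
pairing is monotone in each argument; `wordBound` iterates the worst case. -/
theorem encode_le_wordBound (p : List Bool) : Encodable.encode p ≤ wordBound p.length := by
  induction p with
  | nil => exact Nat.zero_le _
  | cons b l ih =>
    have hb : Encodable.encode b ≤ 1 := by cases b <;> simp
    rw [Encodable.encode_list_cons]
    refine Nat.succ_le_succ ?_
    have h₁ : Monotone fun a => Nat.pair a (Encodable.encode l) :=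
      StrictMono.monotone fun _ _ h => Nat.pair_lt_pair_left _ h
    have h₂ : StrictMono (Nat.pair 1) := fun _ _ h => Nat.pair_lt_pair_right 1 h
    exact (h₁ hb).trans (h₂.monotone ih)

end Computability

/-! ### Comparison up to a constant -/

section Complexity

variable {D : Type*} {φ : List Bool →. D}

theorem K_le {p : List Bool} {d : D} (h : d ∈ φ p) : K φ d ≤ p.length :=
  Nat.sInf_le ⟨p, h, rfl⟩

theorem exists_length_eq_K {d : D} (h : ∃ p, d ∈ φ p) : ∃ p, d ∈ φ p ∧ p.length = K φ d := by
  obtain ⟨p, hp⟩ := h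
  exact Nat.sInf_mem (s := {n : ℕ | ∃ p : List Bool, d ∈ φ p ∧ p.length = n}) ⟨_, p, hp, rfl⟩

theorem LeCt.trans {f g h : D → ℕ} (hfg : LeCt f g) (hgh : LeCt g h) : LeCt f h := by
  obtain ⟨a, ha⟩ := hfg
  obtain ⟨b, hb⟩ := hgh
  refine ⟨a + b, fun d => ?_⟩
  have := ha d
  have := hb d
  omega

/-- A bound with constant `c` is refuted by the translation `n ↦ n + (c + 1)`. -/
theorem not_leCt_of_infinite {f g : D → ℕ}
    (h : ∀ α : ℕ → ℕ, Computable α → {d : D | α (f d) ≤ g d}.Infinite) : ¬ LeCt g f := by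
  rintro ⟨c, hc⟩
  have hα : Computable fun n => n + (c + 1) :=
    Primrec.nat_add.to_comp.comp Computable.id (Computable.const _)
  obtain ⟨d, hd⟩ := (h _ hα).nonempty
  have := hc d
  simp only [Set.mem_ofPred_eq] at hd
  omega

theorem infinite_of_leCt {f g h : D → ℕ} (hgh : LeCt g h)
    (H : ∀ α : ℕ → ℕ, Computable α → {d : D | α (f d) ≤ g d}.Infinite) {α : ℕ → ℕ}
    (hα : Computable α) : {d : D | α (f d) ≤ h d}.Infinite := by
  obtain ⟨c, hc⟩ := hgh
  have hα' : Computable fun n => α n + c :=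
    Primrec.nat_add.to_comp.comp hα (Computable.const _)
  refine (H _ hα').mono fun d hd => ?_
  have := hc d
  simp only [Set.mem_ofPred_eq] at hd ⊢
  omega

end Complexity

/-! ### Total computable approximations -/

section Approximation

variable {D : Type*} [PartialOrder D] {X : Type*} [Primcodable X]

theorem ComputablePoset.exists_decide_lt (𝒟 : ComputablePoset D) :
    ∃ lt : ℕ → ℕ → Bool, Computable₂ lt ∧ ∀ m n, lt m n = true ↔ 𝒟.ρ m < 𝒟.ρ n := by
  obtain ⟨_, h⟩ := 𝒟.computable_lt
  exact ⟨_, h.to₂, fun m n => by simp⟩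

/-- Functions of the class `MaxPR` are limits of eventually constant computable nondecreasing
sequences of elements of `D`, undefined elements being allowed at the beginning. -/
theorem MaxPR.exists_approximation {𝒟 : ComputablePoset D} {F : X →. D} (hF : MaxPR 𝒟 F) :
    ∃ g : X → ℕ → Option ℕ, Computable₂ g ∧
      (∀ x s t v, s ≤ t → g x s = some v → ∃ w, g x t = some w ∧ 𝒟.ρ v ≤ 𝒟.ρ w) ∧
      ∀ x d, d ∈ F x → ∃ s₀, ∀ s, s₀ ≤ s → g x s = some (𝒟.ρ.symm d) := by
  obtain ⟨f, hf, hinc, hmax⟩ := hF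
  obtain ⟨r, hr, hrf⟩ := exists_enumeration hf
  have hval : ∀ x v, (∃ s, r x s = some v) ↔ 𝒟.ρ v ∈ values f x := by
    intro x v
    rw [hrf]
    refine exists_congr fun t => ?_
    simp only [Part.mem_map_iff]
    constructor
    · rintro ⟨a, ha, rfl⟩
      simpa using ha
    · intro h
      exact ⟨_, h, by simp⟩
  have hchain : ∀ x a b, a ∈ values f x → b ∈ values f x → ¬ a < b → b ≤ a := by
    rintro x a b ⟨s, hs⟩ ⟨t, ht⟩ hab
    rcases le_total s t with h | h
    · exact ((hinc x s t a b h hs ht).eq_or_lt.resolve_right hab).ge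
    · exact hinc x t s b a h ht hs
  obtain ⟨lt, hlt, hlt_iff⟩ := 𝒟.exists_decide_lt
  -- Running maximum: values are not enumerated in order of time, so a new one is kept only when
  -- strictly larger. `hchain` makes all values comparable.
  let step : Option ℕ → Option ℕ → Option ℕ := fun o r =>
    Option.casesOn o r fun w => Option.casesOn r o fun v =>
      bif lt w v then some v else some w
  let g : X → ℕ → Option ℕ := fun x s => Nat.rec none (fun y ih => step ih (r x y)) s
  have hg0 : ∀ x, g x 0 = none := fun x => rfl
  have hgs : ∀ x s, g x (s + 1) = step (g x s) (r x s) := fun x s => rfl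
  have hgmem : ∀ x s v, g x s = some v → 𝒟.ρ v ∈ values f x := by
    intro x s
    induction s with
    | zero => intro v hv; simp [hg0] at hv
    | succ s ih =>
      intro v hv
      rw [hgs] at hv
      rcases ho : g x s with _ | w <;> rcases hrr : r x s with _ | u <;>
        simp only [step, ho, hrr] at hv
      · simp at hv
      · exact (hval x v).1 ⟨s, by rw [hrr, hv]⟩
      · exact ih v (by rw [ho, hv])
      · by_cases h : lt w u = true
        · exact (hval x v).1 ⟨s, by simpa [hrr, h] using hv⟩
        · exact ih v (by simpa [ho, h] using hv)
  have hgstep : ∀ x s v, g x s = some v → ∃ w, g x (s + 1) = some w ∧ 𝒟.ρ v ≤ 𝒟.ρ w := by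
    intro x s v hv
    rw [hgs]
    rcases hrr : r x s with _ | u <;> simp only [step, hv]
    · exact ⟨v, rfl, le_rfl⟩
    · by_cases h : lt v u = true
      · exact ⟨u, by simp [h], ((hlt_iff _ _).1 h).le⟩
      · exact ⟨v, by simp [h], le_rfl⟩
  have hgr : ∀ x s v, r x s = some v → ∃ w, g x (s + 1) = some w ∧ 𝒟.ρ v ≤ 𝒟.ρ w := by
    intro x s v hv
    rw [hgs]
    rcases ho : g x s with _ | w <;> simp only [step, hv]
    · exact ⟨v, rfl, le_rfl⟩
    · by_cases h : lt w v = true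
      · exact ⟨v, by simp [h], le_rfl⟩
      · exact ⟨w, by simp [h],
          hchain x _ _ (hgmem x s w ho) ((hval x v).1 ⟨s, hv⟩) fun h' => h ((hlt_iff _ _).2 h')⟩
  have hgmono : ∀ x s t v, s ≤ t → g x s = some v → ∃ w, g x t = some w ∧ 𝒟.ρ v ≤ 𝒟.ρ w := by
    intro x s t v hst hv
    induction t, hst using Nat.le_induction with
    | base => exact ⟨v, hv, le_rfl⟩
    | succ t _ ih =>
      obtain ⟨w, hw, hvw⟩ := ih
      obtain ⟨u, hu, hwu⟩ := hgstep x t w hw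
      exact ⟨u, hu, hvw.trans hwu⟩
  refine ⟨g, ?_, hgmono, ?_⟩
  · refine Computable.nat_rec (h := fun a q => step q.2 (r a.1 q.1)) Computable.snd
      (Computable.const none) ?_
    have hi : Computable fun q : (X × ℕ) × ℕ × Option ℕ => q.2.2 :=
      Computable.snd.comp Computable.snd
    have hy : Computable fun q : (X × ℕ) × ℕ × Option ℕ => r q.1.1 q.2.1 :=
      hr.comp (Computable.fst.comp Computable.fst) (Computable.fst.comp Computable.snd)
    refine Computable.option_casesOn hi hy ?_
    refine Computable.option_casesOn (hy.comp Computable.fst) (hi.comp Computable.fst) ?_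
    have hw : Computable fun q : (((X × ℕ) × ℕ × Option ℕ) × ℕ) × ℕ => q.1.2 :=
      Computable.snd.comp Computable.fst
    exact Computable.cond (hlt.comp hw Computable.snd)
      (Computable.option_some.comp Computable.snd) (Computable.option_some.comp hw)
  · intro x d hd
    obtain ⟨-, hd⟩ := (hmax x d).1 hd
    obtain ⟨s, hs⟩ := (hval x (𝒟.ρ.symm d)).2 (by simpa using hd.1)
    obtain ⟨v, hv, hdv⟩ := hgr x s _ hs
    refine ⟨s + 1, fun t ht => ?_⟩
    obtain ⟨w, hw, hvw⟩ := hgmono x _ t v ht hv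
    have : 𝒟.ρ w = d :=
      le_antisymm (hd.2 (hgmem x t w hw)) (by simpa using hdv.trans hvw)
    rw [hw, ← this, Equiv.symm_apply_apply]

theorem PartialComputable.maxPR {𝒟 : ComputablePoset D} {F : X →. D}
    (hF : PartialComputable 𝒟 F) : MaxPR 𝒟 F := by
  have hF' : Partrec fun x => (F x).map 𝒟.ρ.symm := hF
  refine ⟨fun q => F q.1, hF'.comp Computable.fst, ?_, ?_⟩
  · intro x s t a b _ ha hb
    exact (Part.mem_unique ha hb).le
  · intro x d
    have hv : values (fun q : X × ℕ => F q.1) x = {e | e ∈ F x} := by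
      ext e; simp [values]
    rw [hv]
    constructor
    · intro h
      have : {e | e ∈ F x} = {d} := by
        ext e
        exact ⟨fun he => Part.mem_unique he h, fun he => by rw [he]; exact h⟩
      rw [this]
      exact ⟨Set.finite_singleton d, isGreatest_singleton⟩
    · exact fun h => h.2.1

end Approximation

/-! ### Bounded chains: counting changes -/

section BoundedChains

variable {D : Type*} [PartialOrder D]

theorem leCt_max_plain {𝒟 : ComputablePoset D} {φ U : List Bool →. D}
    (hφ : IsOptimal (PartialComputable 𝒟) φ) (hU : IsOptimal (MaxPR 𝒟) U) :
    LeCt (K U) (K φ) := by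
  obtain ⟨c, hc⟩ := hU.2 φ hφ.1.maxPR
  exact ⟨c, fun d => (hc d (hφ.surjective_plain d)).2⟩

/-- The number of changes of a sequence before the time `s`. -/
def changes (g : ℕ → Option ℕ) (s : ℕ) : ℕ :=
  Nat.rec 0 (fun y ih => bif decide (g (y + 1) = g y) then ih else ih + 1) s

theorem changes_succ (g : ℕ → Option ℕ) (s : ℕ) :
    changes g (s + 1) = if g (s + 1) = g s then changes g s else changes g s + 1 := by
  by_cases h : g (s + 1) = g s <;> simp [changes, h]

theorem monotone_changes (g : ℕ → Option ℕ) : Monotone (changes g) :=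
  monotone_nat_of_le_succ fun s => by rw [changes_succ]; split_ifs <;> omega

/-- The counter never decreases and grows at every change, so equal counts leave no room for a
change in between. -/
theorem eq_of_changes_eq {g : ℕ → Option ℕ} {s t : ℕ} (h : changes g s = changes g t) :
    g s = g t := by
  wlog hst : s ≤ t generalizing s t
  · exact (this h.symm (le_of_not_ge hst)).symm
  induction t, hst using Nat.le_induction with
  | base => rfl
  | succ t hst ih =>
    have h1 := monotone_changes g hst
    have h2 := changes_succ g t
    split_ifs at h2 with h3
    · rw [h3]
      exact ih (by omega)
    · omega

theorem computable_changes {X : Type*} [Primcodable X] {g : X → ℕ → Option ℕ}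
    (hg : Computable₂ g) : Computable₂ fun x s => changes (g x) s := by
  refine Computable.nat_rec
    (h := fun a q => bif decide (g a.1 (q.1 + 1) = g a.1 q.1) then q.2 else q.2 + 1)
    Computable.snd (Computable.const 0) ?_
  have hx : Computable fun q : (X × ℕ) × ℕ × ℕ => q.1.1 := Computable.fst.comp Computable.fst
  have hy : Computable fun q : (X × ℕ) × ℕ × ℕ => q.2.1 := Computable.fst.comp Computable.snd
  have hi : Computable fun q : (X × ℕ) × ℕ × ℕ => q.2.2 := Computable.snd.comp Computable.snd
  exact Computable.cond
    (Primrec.eq.decide.to_comp.comp (hg.comp hx (Computable.succ.comp hy)) (hg.comp hx hy))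
    hi (Computable.succ.comp hi)

/-- A nondecreasing sequence that changes `n` times passes through a chain of `n` elements. -/
theorem exists_chain_card_changes (ρ : ℕ ≃ D) {g : ℕ → Option ℕ}
    (hg : ∀ s t v, s ≤ t → g s = some v → ∃ w, g t = some w ∧ ρ v ≤ ρ w) (s : ℕ) :
    ∃ S : Finset D, IsChain (· < ·) (S : Set D) ∧ changes g s ≤ S.card ∧
      ∀ a ∈ S, ∃ w, g s = some w ∧ a ≤ ρ w := by
  classical
  -- The last clause keeps the chain below the current value, so that a new value can be put on top.
  induction s with
  | zero => exact ⟨∅, by simp, by simp [changes], by simp⟩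
  | succ s ih =>
    obtain ⟨S, hS, hcard, hle⟩ := ih
    have hle' : ∀ a ∈ S, ∃ w, g (s + 1) = some w ∧ a ≤ ρ w := by
      intro a ha
      obtain ⟨w, hw, haw⟩ := hle a ha
      obtain ⟨u, hu, hwu⟩ := hg s (s + 1) w (Nat.le_succ s) hw
      exact ⟨u, hu, haw.trans hwu⟩
    rw [changes_succ]
    split_ifs with h
    · exact ⟨S, hS, hcard, hle'⟩
    -- A change never leads to `none`: a defined value stays defined, and `none` to `none` is no
    -- change.
    · obtain ⟨u, hu⟩ : ∃ u, g (s + 1) = some u := by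
        rcases h1 : g (s + 1) with _ | u
        · rcases h0 : g s with _ | v
          · exact absurd (h1.trans h0.symm) h
          · obtain ⟨u, hu, -⟩ := hg s (s + 1) v (Nat.le_succ s) h0
            exact ⟨u, by rw [← h1, hu]⟩
        · exact ⟨u, rfl⟩
      have hlt : ∀ a ∈ S, a < ρ u := by
        intro a ha
        obtain ⟨w, hw, haw⟩ := hle a ha
        obtain ⟨u', hu', hwu⟩ := hg s (s + 1) w (Nat.le_succ s) hw
        obtain rfl : u = u' := Option.some_injective _ (hu.symm.trans hu')
        refine haw.trans_lt (hwu.lt_of_ne fun he => h ?_)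
        rw [hu, hw, ρ.injective he]
      have hnot : ρ u ∉ S := fun hmem => (hlt _ hmem).false
      refine ⟨insert (ρ u) S, ?_, ?_, ?_⟩
      · rw [Finset.coe_insert]
        exact hS.insert fun b hb _ => Or.inr (hlt b hb)
      · rw [Finset.card_insert_of_notMem hnot]
        omega
      · intro a ha
        rcases Finset.mem_insert.1 ha with rfl | ha
        · exact ⟨u, hu, le_rfl⟩
        · exact hle' a ha

theorem leCt_plain_max {𝒟 : ComputablePoset D} {φ U : List Bool →. D}
    (hφ : IsOptimal (PartialComputable 𝒟) φ) (hU : IsOptimal (MaxPR 𝒟) U)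
    (hD : ¬ HasArbitrarilyLargeFiniteChains D) : LeCt (K φ) (K U) := by
  obtain ⟨N, hN⟩ := not_forall.1 hD
  obtain ⟨g, hg, hmono, hlim⟩ := hU.1.exists_approximation
  have hbound : ∀ p s, changes (g p) s ≤ N := by
    intro p s
    obtain ⟨S, hS, hcard, -⟩ := exists_chain_card_changes 𝒟.ρ (hmono p) s
    by_contra! h
    exact hN ⟨S, hS, by omega⟩
  -- The number of changes `i` is not coded into the word: each `i ≤ N` gets its own function, and
  -- the sum of their constants serves for all.
  let k : ℕ → List Bool → ℕ → Option ℕ := fun i p s =>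
    bif decide (changes (g p) s = i) then g p s else none
  let ψ : ℕ → List Bool →. D := fun i p => (Nat.rfindOpt (k i p)).map 𝒟.ρ
  have hψ : ∀ i, PartialComputable 𝒟 (ψ i) := by
    intro i
    have hk : Computable₂ (k i) :=
      Computable.cond
        (Primrec.eq.decide.to_comp.comp (computable_changes hg) (Computable.const i))
        hg (Computable.const none)
    refine (Partrec.rfindOpt hk).of_eq fun p => ?_
    simp only [ψ, Part.map_map]
    exact (Part.map_id' (fun a => by simp) _).symm
  choose c hc using fun i => hφ.2 (ψ i) (hψ i)
  refine ⟨∑ i ∈ Finset.range (N + 1), c i, fun d => ?_⟩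
  obtain ⟨p, hp, hlen⟩ := exists_length_eq_K (hU.surjective_max d)
  obtain ⟨s, hs⟩ := hlim p d hp
  have hmem : d ∈ ψ (changes (g p) s) p := by
    have hdom : (Nat.rfindOpt (k (changes (g p) s) p)).Dom :=
      Nat.rfindOpt_dom.2 ⟨s, 𝒟.ρ.symm d, by simp [k, hs s le_rfl]⟩
    obtain ⟨a, ha⟩ := Part.dom_iff_mem.1 hdom
    obtain ⟨t, ht⟩ := Nat.rfindOpt_spec ha
    -- The search may stop at a time `t` other than `s`, but the count, hence the value, is the
    -- same.
    have hct : changes (g p) t = changes (g p) s := by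
      by_contra h
      simp [k, h] at ht
    have hga : g p t = some a := by simpa [k, hct] using ht
    rw [eq_of_changes_eq hct, hs s le_rfl] at hga
    refine (Part.mem_map_iff _).2 ⟨a, ha, ?_⟩
    rw [← Option.some_injective _ hga, Equiv.apply_symm_apply]
  have h1 := (hc _ d ⟨p, hmem⟩).2
  have h2 := K_le hmem
  have h3 : c (changes (g p) s) ≤ ∑ i ∈ Finset.range (N + 1), c i :=
    Finset.single_le_sum (f := c) (fun _ _ => Nat.zero_le _)
      (Finset.mem_range.2 (Nat.lt_succ_of_le (hbound p s)))
  omega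

end BoundedChains

/-! ### Large chains: descending past all short descriptions -/

section LargeChains

variable {D : Type*} [PartialOrder D]

/-- A chain of `n + 1` elements can be listed in decreasing order. -/
theorem exists_decreasing_of_isChain (n : ℕ) (s : Finset D) (hs : IsChain (· < ·) (s : Set D))
    (hn : n + 1 ≤ s.card) :
    ∃ e : ℕ → D, (∀ i ≤ n, e i ∈ s) ∧ ∀ i < n, e (i + 1) < e i := by
  classical
  induction n generalizing s with
  | zero =>
    obtain ⟨d, hd⟩ := Finset.card_pos.1 hn
    exact ⟨fun _ => d, fun _ _ => hd, fun i hi => absurd hi (Nat.not_lt_zero i)⟩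
  | succ n ih =>
    obtain ⟨m, hm⟩ := s.exists_maximal (Finset.card_pos.1 (by omega))
    have hlt : ∀ a ∈ s.erase m, a < m := by
      intro a ha
      obtain ⟨hne, ha⟩ := Finset.mem_erase.1 ha
      exact (hs ha hm.1 hne).resolve_right fun h => hm.not_gt ha h
    obtain ⟨e, he, hdec⟩ := ih (s.erase m)
      (hs.mono (Finset.coe_subset.2 (s.erase_subset m)))
      (by rw [Finset.card_erase_of_mem hm.1]; omega)
    refine ⟨fun i => Nat.casesOn i m e, ?_, ?_⟩
    · rintro (_ | i) hi
      · exact hm.1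
      · exact Finset.mem_of_mem_erase (he i (by omega))
    · rintro (_ | i) hi
      · exact hlt _ (he 0 (Nat.zero_le _))
      · exact hdec i (by omega)

/-- Descent is decidable and long chains exist, so a search through coded lists succeeds. The
default entry `0` is harmless, since the check tests the entries as they are read. -/
theorem exists_computable_decreasing (𝒟 : ComputablePoset D)
    (hD : HasArbitrarilyLargeFiniteChains D) :
    ∃ c : ℕ → ℕ → ℕ, Computable₂ c ∧ ∀ n, ∀ i < n, 𝒟.ρ (c n (i + 1)) < 𝒟.ρ (c n i) := by
  obtain ⟨lt, hlt, hlt_iff⟩ := 𝒟.exists_decide_lt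
  let entry : ℕ → ℕ → ℕ := fun k i => (Denumerable.ofNat (List ℕ) k).getD i 0
  have hentry : Computable₂ entry :=
    (Primrec.list_getD 0).to_comp.comp ((Computable.ofNat (List ℕ)).comp Computable.fst)
      Computable.snd
  let check : ℕ → ℕ → Bool := fun n k =>
    Nat.rec true (fun j ih => bif lt (entry k (j + 1)) (entry k j) then ih else false) n
  have hcheck : Computable₂ check := by
    refine Computable.nat_rec
      (h := fun a q => bif lt (entry a.2 (q.1 + 1)) (entry a.2 q.1) then q.2 else false)
      Computable.fst (Computable.const true) ?_
    have hk : Computable fun q : (ℕ × ℕ) × ℕ × Bool => q.1.2 := Computable.snd.comp Computable.fst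
    have hj : Computable fun q : (ℕ × ℕ) × ℕ × Bool => q.2.1 := Computable.fst.comp Computable.snd
    have hi : Computable fun q : (ℕ × ℕ) × ℕ × Bool => q.2.2 := Computable.snd.comp Computable.snd
    exact Computable.cond
      (hlt.comp (hentry.comp hk (Computable.succ.comp hj)) (hentry.comp hk hj))
      hi (Computable.const false)
  have hcheck_iff : ∀ n k, check n k = true ↔
      ∀ i < n, 𝒟.ρ (entry k (i + 1)) < 𝒟.ρ (entry k i) := by
    intro n k
    induction n with
    | zero => simp [check]
    | succ n ih =>
      have hs : check (n + 1) k = (bif lt (entry k (n + 1)) (entry k n) then check n k else false) :=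
        rfl
      rw [hs, Nat.forall_lt_succ_right, ← ih, ← hlt_iff, and_comm]
      cases lt (entry k (n + 1)) (entry k n) <;> simp
  obtain ⟨F, hF, hFcheck⟩ := exists_computable_choice hcheck fun n => by
    obtain ⟨s, hs, hcard⟩ := hD (n + 1)
    obtain ⟨e, -, he⟩ := exists_decreasing_of_isChain n s hs hcard
    refine ⟨Encodable.encode ((List.range (n + 1)).map fun i => 𝒟.ρ.symm (e i)), ?_⟩
    have hval : ∀ i < n + 1, entry
        (Encodable.encode ((List.range (n + 1)).map fun i => 𝒟.ρ.symm (e i))) i =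
          𝒟.ρ.symm (e i) := by
      intro i hi
      simp [entry, List.getD, hi]
    rw [hcheck_iff]
    intro i hi
    rw [hval i (by omega), hval (i + 1) (by omega)]
    simpa using he i hi
  exact ⟨fun n i => entry (F n) i, hentry.comp (hF.comp Computable.fst) Computable.snd,
    fun n => (hcheck_iff n _).1 (hFcheck n)⟩

/-- Starting with `0`, the current index `i` is abandoned for `i + 1` when one of the sequences
`g k` with `k < M` takes the value `c i`. -/
def avoidIndex (g : ℕ → ℕ → Option ℕ) (c : ℕ → ℕ) (M t : ℕ) : ℕ :=
  Nat.rec 0 (fun t i => bif decide (t.unpair.1 < M) then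
    bif decide (g t.unpair.1 t = some (c i)) then i + 1 else i else i) t

theorem avoidIndex_succ (g : ℕ → ℕ → Option ℕ) (c : ℕ → ℕ) (M t : ℕ) :
    avoidIndex g c M (t + 1) =
      if t.unpair.1 < M ∧ g t.unpair.1 t = some (c (avoidIndex g c M t)) then
        avoidIndex g c M t + 1 else avoidIndex g c M t := by
  by_cases h : t.unpair.1 < M <;>
    by_cases h' : g t.unpair.1 t = some (c (avoidIndex g c M t)) <;>
    simp only [avoidIndex] at h' ⊢ <;> simp [h, h']

theorem monotone_avoidIndex (g : ℕ → ℕ → Option ℕ) (c : ℕ → ℕ) (M : ℕ) :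
    Monotone (avoidIndex g c M) :=
  monotone_nat_of_le_succ fun t => by rw [avoidIndex_succ]; split_ifs <;> omega

theorem exists_of_lt_avoidIndex {g : ℕ → ℕ → Option ℕ} {c : ℕ → ℕ} {M i t : ℕ}
    (h : i < avoidIndex g c M t) :
    ∃ s, avoidIndex g c M s = i ∧ ∃ k < M, g k s = some (c i) := by
  induction t with
  | zero => exact absurd h (Nat.not_lt_zero i)
  | succ t ih =>
    rw [avoidIndex_succ] at h
    split_ifs at h with hk
    · rcases Nat.lt_succ_iff_lt_or_eq.1 h with h | rfl
      · exact ih h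
      · exact ⟨t, rfl, _, hk⟩
    · exact ih h

theorem strictAntiOn_of_decreasing {ρ : ℕ → D} {c : ℕ → ℕ} {M : ℕ}
    (hc : ∀ i < M, ρ (c (i + 1)) < ρ (c i)) : StrictAntiOn (fun i => ρ (c i)) (Set.Iic M) :=
  strictAntiOn_Iic_of_succ_lt hc

/-- Pigeonhole: `M + 1` departures caused by `M` sequences would make one sequence show `c i` and
later the strictly lower `c j`. -/
theorem avoidIndex_le {ρ : ℕ → D} {g : ℕ → ℕ → Option ℕ} {c : ℕ → ℕ} {M : ℕ}
    (hg : ∀ k s t v, s ≤ t → g k s = some v → ∃ w, g k t = some w ∧ ρ v ≤ ρ w)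
    (hc : ∀ i < M, ρ (c (i + 1)) < ρ (c i)) (t : ℕ) : avoidIndex g c M t ≤ M := by
  by_contra! h
  choose! s hs k hk hgk using fun i (hi : i < M + 1) =>
    exists_of_lt_avoidIndex (lt_of_lt_of_le hi h)
  obtain ⟨i, hi, j, hj, hne, hij⟩ := Finset.exists_ne_map_eq_of_card_lt_of_maps_to
    (s := Finset.range (M + 1)) (t := Finset.range M) (by simp) (f := k)
    (fun i hi => Finset.mem_coe.2 (Finset.mem_range.2 (hk i (Finset.mem_range.1 hi))))
  rw [Finset.mem_range] at hi hj
  wlog hlt : i < j generalizing i j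
  · exact this j hj i hi hne.symm hij.symm (lt_of_le_of_ne (not_lt.1 hlt) hne.symm)
  have hst : s i ≤ s j := by
    by_contra! hst
    have := monotone_avoidIndex g c M hst.le
    rw [hs i hi, hs j hj] at this
    omega
  obtain ⟨w, hw, hle⟩ := hg _ _ _ _ hst (hgk i hi)
  rw [hij, hgk j hj] at hw
  rw [← Option.some_injective _ hw] at hle
  exact (strictAntiOn_of_decreasing hc (Nat.le_of_lt_succ hi) (Nat.le_of_lt_succ hj) hlt).not_ge hle

/-- The index stabilizes at an element of the chain that is the eventual value of none of the
sequences `g k` with `k < M`. -/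
theorem exists_avoidIndex_limit {ρ : ℕ → D} {g : ℕ → ℕ → Option ℕ} {c : ℕ → ℕ} {M : ℕ}
    (hg : ∀ k s t v, s ≤ t → g k s = some v → ∃ w, g k t = some w ∧ ρ v ≤ ρ w)
    (hc : ∀ i < M, ρ (c (i + 1)) < ρ (c i)) :
    ∃ t₀, (∀ t, avoidIndex g c M t ≤ avoidIndex g c M t₀) ∧
      ∀ k < M, ¬ ∃ s₀, ∀ s, s₀ ≤ s → g k s = some (c (avoidIndex g c M t₀)) := by
  have hbdd : BddAbove (Set.range (avoidIndex g c M)) :=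
    ⟨M, by rintro _ ⟨t, rfl⟩; exact avoidIndex_le hg hc t⟩
  obtain ⟨t₀, ht₀⟩ := Nat.sSup_mem (Set.range_nonempty _) hbdd
  have hmax : ∀ t, avoidIndex g c M t ≤ avoidIndex g c M t₀ := fun t => by
    rw [ht₀]
    exact le_csSup hbdd ⟨t, rfl⟩
  refine ⟨t₀, hmax, ?_⟩
  rintro k hk ⟨s₀, hs₀⟩
  -- A stage past `s₀` and `t₀` that inspects sequence `k`; there the index would have to move
  -- again.
  let t := Nat.pair k (max s₀ t₀)
  have ht : max s₀ t₀ ≤ t := Nat.right_le_pair _ _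
  have heq : avoidIndex g c M t = avoidIndex g c M t₀ :=
    le_antisymm (hmax t) (monotone_avoidIndex g c M ((le_max_right _ _).trans ht))
  have hkt : t.unpair.1 = k := by simp [t]
  have hsucc := avoidIndex_succ g c M t
  rw [hkt, heq, if_pos ⟨hk, hs₀ t ((le_max_left _ _).trans ht)⟩] at hsucc
  have := hmax (t + 1)
  omega

theorem computable_avoidIndex {g : ℕ → ℕ → Option ℕ} (hg : Computable₂ g) {c : ℕ → ℕ → ℕ}
    (hc : Computable₂ c) {M : ℕ → ℕ} (hM : Computable M) :
    Computable₂ fun n t => avoidIndex g (c n) (M n) t := by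
  refine Computable.nat_rec
    (h := fun a q => bif decide (q.1.unpair.1 < M a.1) then
      bif decide (g q.1.unpair.1 q.1 = some (c a.1 q.2)) then q.2 + 1 else q.2 else q.2)
    Computable.snd (Computable.const 0) ?_
  have hn : Computable fun q : (ℕ × ℕ) × ℕ × ℕ => q.1.1 := Computable.fst.comp Computable.fst
  have ht : Computable fun q : (ℕ × ℕ) × ℕ × ℕ => q.2.1 := Computable.fst.comp Computable.snd
  have hi : Computable fun q : (ℕ × ℕ) × ℕ × ℕ => q.2.2 := Computable.snd.comp Computable.snd
  have hk : Computable fun q : (ℕ × ℕ) × ℕ × ℕ => q.2.1.unpair.1 :=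
    Computable.fst.comp (Computable.unpair.comp ht)
  exact Computable.cond (Primrec.nat_lt.decide.to_comp.comp hk (hM.comp hn))
    (Computable.cond
      (Primrec.eq.decide.to_comp.comp (hg.comp hk ht) (Computable.option_some.comp (hc.comp hn hi)))
      (Computable.succ.comp hi) hi) hi

theorem infinite_setOf_le_max {𝒟 : ComputablePoset D} {U V : List Bool →. D}
    (hU : IsOptimal (MaxPR 𝒟) U) (hV : IsOptimal (MinPR 𝒟) V)
    (hD : HasArbitrarilyLargeFiniteChains D) {α : ℕ → ℕ} (hα : Computable α) :
    {d : D | α (K V d) ≤ K U d}.Infinite := by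
  obtain ⟨β, hβ, hβmono, hαβ, hβid⟩ := exists_monotone_computable_ge hα
  obtain ⟨g, hg, hgmono, hlim⟩ := hU.1.exists_approximation
  obtain ⟨c, hc, hcdec⟩ := exists_computable_decreasing 𝒟 hD
  -- Words are indexed by their codes; numbers coding no word give the constant `none`, which never
  -- triggers a step.
  let G : ℕ → ℕ → Option ℕ := fun k s => (Encodable.decode (α := List Bool) k).bind fun p => g p s
  have hG : Computable₂ G :=
    Computable.option_bind (Computable.decode.comp Computable.fst)
      (hg.comp Computable.snd (Computable.snd.comp Computable.fst))
  have hGmono : ∀ k s t v, s ≤ t → G k s = some v → ∃ w, G k t = some w ∧ 𝒟.ρ v ≤ 𝒟.ρ w := by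
    intro k s t v hst hv
    obtain ⟨p, hp, hv⟩ := Option.bind_eq_some_iff.1 hv
    obtain ⟨w, hw, hle⟩ := hgmono p s t v hst hv
    exact ⟨w, by simp [G, hp, hw], hle⟩
  -- The factor `2` absorbs the constant `b` of `V` found below: `n + b ≤ 2 * n` once `n ≥ b`.
  let M : ℕ → ℕ := fun n => wordBound (β (2 * n)) + 1
  have hM : Computable M :=
    Computable.succ.comp (computable_wordBound.comp
      (hβ.comp (Primrec.nat_mul.to_comp.comp (Computable.const 2) Computable.id)))
  have hcM : Computable₂ fun n i => c (M n) i :=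
    hc.comp (hM.comp Computable.fst) Computable.snd
  let I : ℕ → ℕ → ℕ := fun n t => avoidIndex G (c (M n)) (M n) t
  have hI : Computable₂ I := computable_avoidIndex hG hcM hM
  have hIle : ∀ n t, I n t ≤ M n := fun n => avoidIndex_le hGmono (hcdec (M n))
  choose T hT hTavoid using fun n => exists_avoidIndex_limit hGmono (hcdec (M n))
  have hanti : ∀ n i j, i ≤ j → j ≤ M n → 𝒟.ρ (c (M n) j) ≤ 𝒟.ρ (c (M n) i) :=
    fun n i j hij hj => (strictAntiOn_of_decreasing (hcdec (M n))).antitoneOn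
      (Set.mem_Iic.2 (hij.trans hj)) (Set.mem_Iic.2 hj) hij
  let d : ℕ → D := fun n => 𝒟.ρ (c (M n) (I n (T n)))
  have hψ : MinPR 𝒟 fun p : List Bool => Part.some (d p.length) := by
    refine ⟨fun q => Part.some (𝒟.ρ (c (M q.1.length) (I q.1.length q.2))), ?_, ?_, ?_⟩
    · have hlen : Computable fun q : List Bool × ℕ => q.1.length :=
        Computable.list_length.comp Computable.fst
      have h : Computable fun q : List Bool × ℕ => c (M q.1.length) (I q.1.length q.2) :=
        hcM.comp hlen (hI.comp hlen Computable.snd)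
      exact h.partrec.of_eq fun q => by simp
    · intro p s t a b hst ha hb
      rw [Part.mem_some_iff] at ha hb
      rw [ha, hb]
      exact hanti _ _ _ (monotone_avoidIndex _ _ _ hst) (hIle _ _)
    · intro p e
      have hfin : (values (fun q : List Bool × ℕ =>
          Part.some (𝒟.ρ (c (M q.1.length) (I q.1.length q.2)))) p).Finite := by
        refine ((Set.finite_Iic (M p.length)).image
          fun i => 𝒟.ρ (c (M p.length) i)).subset ?_
        rintro a ⟨t, ht⟩
        exact ⟨_, hIle p.length t, (Part.mem_some_iff.1 ht).symm⟩
      have hleast : IsLeast (values (fun q : List Bool × ℕ =>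
          Part.some (𝒟.ρ (c (M q.1.length) (I q.1.length q.2)))) p) (d p.length) := by
        refine ⟨⟨T p.length, Part.mem_some _⟩, ?_⟩
        rintro a ⟨t, ht⟩
        rw [Part.mem_some_iff.1 ht]
        exact hanti _ _ _ (hT _ t) (hIle _ _)
      rw [Part.mem_some_iff]
      exact ⟨fun h => ⟨hfin, h ▸ hleast⟩, fun h => h.2.unique hleast⟩
  obtain ⟨b, hb⟩ := hV.2 _ hψ
  have hKV : ∀ n, K V (d n) ≤ n + b := by
    intro n
    have hmem : d n ∈ (fun p : List Bool => Part.some (d p.length)) (List.replicate n true) := by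
      simp
    have h1 := (hb (d n) ⟨_, hmem⟩).2
    have h2 := K_le (φ := fun p : List Bool => Part.some (d p.length)) hmem
    rw [List.length_replicate] at h2
    omega
  have hKU : ∀ n, β (2 * n) ≤ K U (d n) := by
    intro n
    by_contra! h
    obtain ⟨p, hp, hlen⟩ := exists_length_eq_K (hU.surjective_max (d n))
    have hcode : Encodable.encode p < M n :=
      Nat.lt_succ_of_le ((encode_le_wordBound p).trans (monotone_wordBound (by omega)))
    obtain ⟨s₀, hs₀⟩ := hlim p _ hp
    exact hTavoid n _ hcode ⟨s₀, fun s hs => by simpa [G, d] using hs₀ s hs⟩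
  -- The `d n` might repeat; infinitude comes from `K U (d n) ≥ β (2 * n) ≥ 2 * n` being unbounded.
  refine Set.Infinite.of_image (K U) (Set.infinite_of_forall_exists_gt fun N => ?_)
  refine ⟨_, ⟨d (max b (N + 1)), ?_, rfl⟩, ?_⟩
  · exact (hαβ _).trans ((hβmono (by have := hKV (max b (N + 1)); omega)).trans (hKU _))
  · have h1 := hKU (max b (N + 1))
    have h2 := hβid (2 * max b (N + 1))
    omega

end LargeChains

/-! ### Order reversal -/

section Duality

variable {D : Type*} [PartialOrder D]

/-- The same enumeration, with the order reversed. -/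
def ComputablePoset.dual (𝒟 : ComputablePoset D) : ComputablePoset Dᵒᵈ where
  ρ := 𝒟.ρ.trans OrderDual.toDual
  computable_lt := by
    obtain ⟨lt, hlt, hlt_iff⟩ := 𝒟.exists_decide_lt
    refine ⟨fun p => decidable_of_iff (lt p.2 p.1 = true) (hlt_iff p.2 p.1), ?_⟩
    refine (hlt.comp Computable.snd Computable.fst).of_eq fun p => ?_
    rw [Bool.eq_iff_iff, @decide_eq_true_iff]
    exact hlt_iff p.2 p.1

/-- Holds by unfolding: reversal exchanges increasing with decreasing and greatest with least. -/
theorem IsOptimal.dual_min {𝒟 : ComputablePoset D} {V : List Bool →. D}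
    (h : IsOptimal (MinPR 𝒟) V) : IsOptimal (D := Dᵒᵈ) (MaxPR 𝒟.dual) V := h

theorem IsOptimal.dual_max {𝒟 : ComputablePoset D} {U : List Bool →. D}
    (h : IsOptimal (MaxPR 𝒟) U) : IsOptimal (D := Dᵒᵈ) (MinPR 𝒟.dual) U := h

theorem IsOptimal.dual_plain {𝒟 : ComputablePoset D} {φ : List Bool →. D}
    (h : IsOptimal (PartialComputable 𝒟) φ) :
    IsOptimal (D := Dᵒᵈ) (PartialComputable 𝒟.dual) φ := h

theorem HasArbitrarilyLargeFiniteChains.dual (h : HasArbitrarilyLargeFiniteChains D) :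
    HasArbitrarilyLargeFiniteChains Dᵒᵈ := fun n => by
  obtain ⟨s, hs, hn⟩ := h n
  exact ⟨s, fun a ha b hb hab => (hs ha hb hab).symm, hn⟩

end Duality

end MaxMinComplexity

/-! ### Assembly of both cases -/

theorem theorem4p2 {D : Type*} [PartialOrder D] (𝒟 : ComputablePoset D)
    (φ U V : List Bool →. D)
    (hφ : IsOptimal (PartialComputable 𝒟) φ)
    (hU : IsOptimal (MaxPR 𝒟) U)
    (hV : IsOptimal (MinPR 𝒟) V) :
    (HasArbitrarilyLargeFiniteChains D →
      (¬ LeCt (K U) (K V) ∧ ¬ LeCt (K V) (K U) ∧ LtCt (K U) (K φ) ∧ LtCt (K V) (K φ)) ∧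
      ∀ α : ℕ → ℕ, Computable α →
        {d : D | α (K V d) ≤ K φ d}.Infinite ∧
        {d : D | α (K U d) ≤ K φ d}.Infinite ∧
        {d : D | α (K V d) ≤ K U d}.Infinite ∧
        {d : D | α (K U d) ≤ K V d}.Infinite) ∧
    (¬ HasArbitrarilyLargeFiniteChains D →
      EqCt (K V) (K U) ∧ EqCt (K U) (K φ)) := by
  have hUφ : LeCt (K U) (K φ) := leCt_max_plain hφ hU
  have hVφ : LeCt (K V) (K φ) := leCt_max_plain (D := Dᵒᵈ) hφ.dual_plain hV.dual_min
  constructor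
  · intro hD
    have hVU : ∀ α : ℕ → ℕ, Computable α → {d : D | α (K V d) ≤ K U d}.Infinite :=
      fun α hα => infinite_setOf_le_max hU hV hD hα
    have hUV : ∀ α : ℕ → ℕ, Computable α → {d : D | α (K U d) ≤ K V d}.Infinite :=
      fun α hα => infinite_setOf_le_max (D := Dᵒᵈ) hV.dual_min hU.dual_max hD.dual hα
    have hVφ' : ∀ α : ℕ → ℕ, Computable α → {d : D | α (K V d) ≤ K φ d}.Infinite :=
      fun α hα => infinite_of_leCt hUφ hVU hα
    have hUφ' : ∀ α : ℕ → ℕ, Computable α → {d : D | α (K U d) ≤ K φ d}.Infinite :=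
      fun α hα => infinite_of_leCt hVφ hUV hα
    exact ⟨⟨not_leCt_of_infinite hVU, not_leCt_of_infinite hUV, ⟨hUφ, not_leCt_of_infinite hUφ'⟩,
      hVφ, not_leCt_of_infinite hVφ'⟩, fun α hα => ⟨hVφ' α hα, hUφ' α hα, hVU α hα, hUV α hα⟩⟩
  · intro hD
    have hφU : LeCt (K φ) (K U) := leCt_plain_max hφ hU hD
    have hφV : LeCt (K φ) (K V) := leCt_plain_max (D := Dᵒᵈ) hφ.dual_plain hV.dual_min
      fun h => hD h.dual
    exact ⟨⟨hVφ.trans hφU, hUφ.trans hφV⟩, hUφ, hφU⟩
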